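/- Let $H\in(\tfrac12,1)$, let $(B^H(t))_{t\ge 0}$ be a fractional Brownian motion with Hurst parameter $H$ on a probability space, that is, a Gaussian process with almost surely continuous paths, $\mathbb E B^H(t)=B^H(0)$ (so that $B^H(0)$ is almost surely constant) and $\operatorname{Cov}(B^H(t),B^H(s))=\tfrac12\left(t^{2H}+s^{2H}-|t-s|^{2H}\right)$ for all $s,t\ge 0$. Let $T>0$, $S(t)=e^{B^H(t)}$ and $$G(t)=\exp\left(\frac1T\int_0^t\log S(s)\,ds\right)S(t)^{\frac{T-t}{T}},\qquad t\in[0,T].$$ Then, almost surely, for all $t\in[0,T]$, $$G(t)=S(0)+\int_0^t\frac{T-s}{T}\,G(s)\,dB^H(s).$$ In particular, almost surely, $$\exp\left(\frac1T\int_0^T B^H(s)\,ds\right)=S(0)+\int_0^T\frac{T-s}{T}\exp\left(\frac1T\int_0^s B^H(u)\,du+\frac{T-s}{T}B^H(s)\right)dB^H(s).$$ Here the stochastic integrals are pathwise limits of Riemann sums: $\int_0^t f(s)\,dB^H(s)$ is the limit, whose existence is part of the claim, of $\sum_{i<n} f(\xi_i)\left(B^H(t_{i+1})-B^H(t_i)\right)$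 over partitions $0=t_0\le t_1\le\dots\le t_n=t$ with tags $\xi_i\in[t_i,t_{i+1}]$ as $\max_i(t_{i+1}-t_i)\to0$; on one event of probability one it exists for all $t\in[0,T]$, and it does not depend on the choice of the partitions and the tags. -/

import Mathlib

open MeasureTheory ProbabilityTheory
open scoped NNReal

/-- `B = (B t)_{t ≥ 0}` is a fractional Brownian motion with Hurst parameter `H` under `P`: a
Gaussian process with almost surely continuous paths, constant mean equal to the (deterministic)
starting value `B 0`, and covariance `(t^{2H} + s^{2H} - |t - s|^{2H}) / 2`. -/
structure IsFractionalBrownianMotion {Ω : Type*} [MeasurableSpace Ω] (P : Measure Ω) (H : ℝ)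
    (B : ℝ≥0 → Ω → ℝ) : Prop where
  isGaussianProcess : IsGaussianProcess B P
  mean_eq : ∀ t : ℝ≥0, ∀ᵐ ω ∂P, ∫ ω', B t ω' ∂P = B 0 ω
  covariance_eq : ∀ t s : ℝ≥0, covariance (B t) (B s) P =
    1 / 2 * ((t : ℝ) ^ (2 * H) + (s : ℝ) ^ (2 * H) - |(t : ℝ) - (s : ℝ)| ^ (2 * H))
  continuous_paths : ∀ᵐ ω ∂P, Continuous fun t : ℝ≥0 => B t ω

/-- The exponential `S(t) = exp (B t)`; for a fractional Brownian motion `B` this is the geometric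
fractional Brownian motion. -/
noncomputable def geometricProcess {Ω : Type*} (B : ℝ≥0 → Ω → ℝ) (t : ℝ≥0) (ω : Ω) : ℝ :=
  Real.exp (B t ω)

/-- `G(t) = exp ((1/T) ∫₀ᵗ log S(s) ds) * S(t) ^ ((T - t) / T)`, where `S = exp B`. The variable of
integration `s` runs over the real interval `[0, t]`, on which `s.toNNReal` is just `s`. -/
noncomputable def geometricAverage {Ω : Type*} (B : ℝ≥0 → Ω → ℝ) (T t : ℝ≥0) (ω : Ω) : ℝ :=
  Real.exp (1 / (T : ℝ) *
      ∫ s in (0 : ℝ)..(t : ℝ), Real.log (geometricProcess B s.toNNReal ω)) *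
    geometricProcess B t ω ^ (((T : ℝ) - (t : ℝ)) / (T : ℝ))

/-- The Riemann sum `∑_{i < n} f(ξ i) (g(π (i+1)) - g(π i))`. -/
def riemannSum (f g : ℝ≥0 → ℝ) (n : ℕ) (π ξ : ℕ → ℝ≥0) : ℝ :=
  ∑ i ∈ Finset.range n, f (ξ i) * (g (π (i + 1)) - g (π i))

/-- `a = π 0 ≤ π 1 ≤ ⋯ ≤ π n = b` is a partition of `[a, b]` with tags
`ξ i ∈ [π i, π (i+1)]` and with maximum step size less than `δ`. -/
def IsTaggedPartition (a b : ℝ≥0) (δ : ℝ) (n : ℕ) (π ξ : ℕ → ℝ≥0) : Prop :=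
  π 0 = a ∧ π n = b ∧
    ∀ i < n, π i ≤ ξ i ∧ ξ i ≤ π (i + 1) ∧ (π (i + 1) : ℝ) - (π i : ℝ) < δ

/-- `I` is the integral of `f` with respect to `g` over `[a, b]` as the limit of Riemann sums:
whatever the partitions and the tags, the Riemann sums tend to `I` as the maximum step size
goes to zero. -/
def IsRiemannSumLimit (f g : ℝ≥0 → ℝ) (a b : ℝ≥0) (I : ℝ) : Prop :=
  ∀ ε : ℝ, 0 < ε → ∃ δ : ℝ, 0 < δ ∧ ∀ (n : ℕ) (π ξ : ℕ → ℝ≥0),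
    IsTaggedPartition a b δ n π ξ → |riemannSum f g n π ξ - I| < ε

/-!
The argument is pathwise, on the event where the path `b = B · ω` is continuous and locally
Hölder on `[0, T]` of some order `α ∈ (1/2, H)`.

That this event has probability one is Kolmogorov's argument
(`IsFractionalBrownianMotion.ae_holder`). The increment `B t - B s` is centred Gaussian with
standard deviation `|t - s| ^ H`, so its `p`-th absolute moment is a constant times
`|t - s| ^ (H p)`. For `p > 1 / (H - α)` the `p`-th powers of all dyadic increments, each divided by
the `α p`-th power of its length, have summable expectations; hence almost surely all dyadic
increments are `O((2⁻ⁿ)^α)` (`ae_dyadic_increments_le`), and chaining along dyadic approximations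
turns this into a Hölder bound (`exists_holder_of_dyadic_increments`).

On such a path, write `G = exp u` with `u x = (1/T) ∫₀ˣ b + ((T - x) / T) b x` (`logAverage`). By
the product rule the two terms `± b x dx / T` cancel, so that on an interval `[s, t]` with tag `ξ` the
increment of `u` is `((T - ξ) / T) (b t - b s)` up to `O((t - s)^(1 + α))`
(`abs_logAverage_sub_sub_le`). In particular `u` is itself `α`-Hölder, and the Taylor expansion of
`exp` at `u ξ` gives
`G t - G s = ((T - ξ) / T) G ξ (b t - b s) + O((t - s)^(1 + α) + (t - s)^(2 α))`
(`abs_exp_logAverage_sub_sub_le`). As `2 α > 1`, the error is `o(t - s)` uniformly, so its sum over a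
partition tends to `0` with the mesh, whatever the partition and the tags, while the left-hand
sides telescope (`isRiemannSumLimit_of_increment_approx`).
-/

/-! ### Hölder continuity from dyadic increments -/

open Filter Topology in
/-- If all increments of a continuous function over dyadic intervals of length `2⁻ⁿ` in `[0, N]`
are at most `K (2⁻ⁿ)^α`, then the function is locally `α`-Hölder on `[0, N]`. -/
theorem exists_holder_of_dyadic_increments {b : ℝ → ℝ} (hb : Continuous b) {K α : ℝ} (hK : 0 ≤ K)
    (hα : 0 < α) {N : ℕ}
    (h : ∀ n k : ℕ, k < N * 2 ^ n →
      |b (((k + 1 : ℕ) : ℝ) / 2 ^ n) - b ((k : ℝ) / 2 ^ n)| ≤ K * ((1 / 2 : ℝ) ^ α) ^ n) :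
    ∃ L : ℝ, 0 ≤ L ∧ ∀ s t : ℝ, 0 ≤ s → s ≤ t → t ≤ N → t - s ≤ 1 →
      |b t - b s| ≤ L * (t - s) ^ α := by
  set r : ℝ := (1 / 2 : ℝ) ^ α with hr
  have hr0 : 0 < r := by positivity
  have hr1 : r < 1 := Real.rpow_lt_one (by norm_num) (by norm_num) hα
  -- `d n s` is the largest dyadic number of level `n` below `s`.
  let d : ℕ → ℝ → ℝ := fun n s => (⌊s * 2 ^ n⌋₊ : ℝ) / 2 ^ n
  have hd_floor : ∀ s : ℝ, s ≤ N → ∀ n : ℕ, ⌊s * 2 ^ n⌋₊ ≤ N * 2 ^ n := by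
    intro s hsN n
    apply Nat.floor_le_of_le
    push_cast
    gcongr
  have hstep : ∀ s : ℝ, 0 ≤ s → s ≤ N → ∀ n : ℕ,
      dist (b (d n s)) (b (d (n + 1) s)) ≤ K * r ^ n := by
    intro s hs hsN n
    have hN := hd_floor s hsN (n + 1)
    have h2 : ⌊s * 2 ^ (n + 1)⌋₊ / 2 = ⌊s * 2 ^ n⌋₊ := by
      rw [← Nat.floor_div_ofNat]
      congr 1
      rw [pow_succ]
      ring
    have hpow : K * r ^ (n + 1) ≤ K * r ^ n :=
      mul_le_mul_of_nonneg_left (pow_le_pow_of_le_one hr0.le hr1.le n.le_succ) hK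
    have hdn : d n s = ((2 * ⌊s * 2 ^ n⌋₊ : ℕ) : ℝ) / 2 ^ (n + 1) := by
      simp only [d]
      push_cast
      rw [pow_succ]
      field_simp
    rcases (by omega : ⌊s * 2 ^ (n + 1)⌋₊ = 2 * ⌊s * 2 ^ n⌋₊ ∨
        ⌊s * 2 ^ (n + 1)⌋₊ = 2 * ⌊s * 2 ^ n⌋₊ + 1) with h3 | h3
    · have : d (n + 1) s = d n s := by rw [hdn, ← h3]
      rw [this, dist_self]
      positivity
    · have hk := h (n + 1) (2 * ⌊s * 2 ^ n⌋₊) (by omega)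
      rw [dist_comm, Real.dist_eq, hdn]
      simp only [d]
      rw [h3]
      exact hk.trans hpow
  have hlim : ∀ s : ℝ, 0 ≤ s → s ≤ N → ∀ n : ℕ, |b (d n s) - b s| ≤ K * r ^ n / (1 - r) := by
    intro s hs hsN n
    have hds : Tendsto (fun n => d n s) atTop (𝓝 s) :=
      (tendsto_nat_floor_mul_div_atTop hs).comp
        (tendsto_pow_atTop_atTop_of_one_lt (by norm_num : (1 : ℝ) < 2))
    rw [← Real.dist_eq]
    exact dist_le_of_le_geometric_of_tendsto r K hr1 (hstep s hs hsN) ((hb.tendsto s).comp hds) n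
  refine ⟨(K + 2 * (K / (1 - r))) / r, ?_, ?_⟩
  · have : 0 < 1 - r := by linarith
    positivity
  intro s t hs hst htN hts
  rcases hst.eq_or_lt with rfl | hlt
  · simp [Real.zero_rpow hα.ne']
  obtain ⟨n, hn1, hn2⟩ := exists_nat_pow_near_of_lt_one (sub_pos.2 hlt) hts
    (by norm_num : (0 : ℝ) < 1 / 2) (by norm_num)
  have hmid : |b (d n t) - b (d n s)| ≤ K * r ^ n := by
    have hp : (0 : ℝ) < 2 ^ n := by positivity
    have h1 : t * 2 ^ n ≤ s * 2 ^ n + 1 := by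
      have : (t - s) * 2 ^ n ≤ (1 / 2 : ℝ) ^ n * 2 ^ n := by gcongr
      rw [← mul_pow] at this
      norm_num at this
      linarith
    have h2 : ⌊s * 2 ^ n⌋₊ ≤ ⌊t * 2 ^ n⌋₊ := Nat.floor_le_floor (by gcongr)
    have h3 : ⌊t * 2 ^ n⌋₊ ≤ ⌊s * 2 ^ n⌋₊ + 1 := by
      rw [← Nat.floor_add_one (by positivity)]
      exact Nat.floor_le_floor h1
    have hN := hd_floor t htN n
    rcases (by omega : ⌊t * 2 ^ n⌋₊ = ⌊s * 2 ^ n⌋₊ ∨ ⌊t * 2 ^ n⌋₊ = ⌊s * 2 ^ n⌋₊ + 1) with h4 | h4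
    · simp only [d, h4, sub_self, abs_zero]
      positivity
    · simp only [d, h4]
      exact h n _ (by omega)
  have hrn : r ^ (n + 1) ≤ (t - s) ^ α := by
    rw [hr, ← Real.rpow_natCast, ← Real.rpow_mul (by norm_num), mul_comm α,
      Real.rpow_mul (by norm_num), Real.rpow_natCast]
    exact Real.rpow_le_rpow (by positivity) hn1.le hα.le
  have ht' := hlim t (hs.trans hst) htN n
  have hs' := hlim s hs (hst.trans htN) n
  have hC : 0 ≤ (K + 2 * (K / (1 - r))) / r := by
    have : 0 < 1 - r := by linarith
    positivity
  calc |b t - b s| ≤ |b (d n t) - b t| + |b (d n t) - b (d n s)| + |b (d n s) - b s| := by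
        have e : b t - b s = -(b (d n t) - b t) + (b (d n t) - b (d n s)) + (b (d n s) - b s) := by
          ring
        rw [e]
        refine (abs_add_three _ _ _).trans_eq ?_
        rw [abs_neg]
    _ ≤ K * r ^ n / (1 - r) + K * r ^ n + K * r ^ n / (1 - r) := by gcongr
    _ = (K + 2 * (K / (1 - r))) / r * r ^ (n + 1) := by
        rw [pow_succ]
        field_simp
        ring
    _ ≤ (K + 2 * (K / (1 - r))) / r * (t - s) ^ α := by gcongr

/-! ### Moments of Gaussian increments and Kolmogorov's argument -/

/-- The `p`-th absolute moment of a centred Gaussian law is the `p`-th power of its standard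
deviation times the moment of the standard normal law. -/
theorem lintegral_enorm_pow_gaussianReal (σ : ℝ≥0) (p : ℕ) :
    ∫⁻ x, ‖x‖ₑ ^ p ∂(gaussianReal 0 (σ ^ 2)) =
      (σ : ENNReal) ^ p * ∫⁻ x, ‖x‖ₑ ^ p ∂(gaussianReal 0 1) := by
  have hmap : gaussianReal 0 (σ ^ 2) = (gaussianReal 0 1).map ((σ : ℝ) * ·) := by
    rw [gaussianReal_map_const_mul]
    congr 1
    · simp
    · ext
      simp
  rw [hmap, lintegral_map (by fun_prop) (by fun_prop), ← lintegral_const_mul _ (by fun_prop)]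
  simp [enorm_mul, mul_pow]

theorem lintegral_enorm_pow_gaussianReal_lt_top (p : ℕ) :
    ∫⁻ x, ‖x‖ₑ ^ p ∂(gaussianReal 0 1) < ⊤ := by
  have h := (memLp_id_gaussianReal (μ := 0) (v := 1) (p : ℝ≥0)).integrable_norm_pow'
  have h2 := h.2
  simpa [HasFiniteIntegral] using h2

section

variable {Ω : Type*} [MeasurableSpace Ω] {P : Measure Ω}

/-- Kolmogorov's argument: the moment bound `𝔼 |X t - X s| ^ p ≤ C |t - s| ^ (H p)` makes the
increments over all dyadic intervals of length `2⁻ⁿ` in `[0, N]` almost surely `O((2⁻ⁿ)^α)`,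
when `(H - α) p > 1`. -/
theorem ae_dyadic_increments_le {X : ℝ≥0 → Ω → ℝ} (hX : ∀ t, AEMeasurable (X t) P) {H α : ℝ}
    {p : ℕ} (hp : 1 < (H - α) * p) {C : ENNReal} (hC : C ≠ ⊤)
    (hmom : ∀ s t : ℝ≥0, ∫⁻ ω, ‖X t ω - X s ω‖ₑ ^ p ∂P ≤
      C * ENNReal.ofReal (|(t : ℝ) - s| ^ H) ^ p) (N : ℕ) :
    ∀ᵐ ω ∂P, ∃ K : ℝ, 0 ≤ K ∧ ∀ n k : ℕ, k < N * 2 ^ n →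
      |X (((k + 1 : ℕ) : ℝ≥0) / 2 ^ n) ω - X ((k : ℝ≥0) / 2 ^ n) ω| ≤
        K * ((1 / 2 : ℝ) ^ α) ^ n := by
  have hp0 : p ≠ 0 := by
    rintro rfl
    norm_num at hp
  set ρ : ℝ := (1 / 2 : ℝ) ^ α with hρ
  have hρ0 : 0 < ρ := by positivity
  -- the increments at level `n`, normalised by `(2⁻ⁿ)^α`
  let Y : ℕ → ℕ → Ω → ENNReal := fun n k ω =>
    ‖(ρ ^ n)⁻¹ * (X (((k + 1 : ℕ) : ℝ≥0) / 2 ^ n) ω - X ((k : ℝ≥0) / 2 ^ n) ω)‖ₑ ^ p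
  have hYm : ∀ n k, AEMeasurable (Y n k) P := fun n k =>
    ((((hX _).sub (hX _)).const_mul _).enorm).pow_const p
  let θ : ℝ := 2 * ((1 / 2 : ℝ) ^ (H - α)) ^ p
  have hθ0 : 0 ≤ θ := by positivity
  have hθ1 : θ < 1 := by
    have : ((1 / 2 : ℝ) ^ (H - α)) ^ p < 1 / 2 := by
      rw [← Real.rpow_natCast, ← Real.rpow_mul (by norm_num)]
      conv_rhs => rw [← Real.rpow_one (1 / 2 : ℝ)]
      exact Real.rpow_lt_rpow_of_exponent_gt (by norm_num) (by norm_num) hp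
    simp only [θ]
    linarith
  have hY : ∀ n k, ∫⁻ ω, Y n k ω ∂P ≤
      C * ENNReal.ofReal (((1 / 2 : ℝ) ^ (H - α)) ^ p) ^ n := by
    intro n k
    have hdist : |((((k + 1 : ℕ) : ℝ≥0) / 2 ^ n : ℝ≥0) : ℝ) - (((k : ℝ≥0) / 2 ^ n : ℝ≥0) : ℝ)| =
        (1 / 2 : ℝ) ^ n := by
      push_cast
      rw [← sub_div, add_sub_cancel_left, abs_of_nonneg (by positivity), one_div_pow]
    have hscale : (ρ ^ n)⁻¹ * ((1 / 2 : ℝ) ^ n) ^ H = ((1 / 2 : ℝ) ^ (H - α)) ^ n := by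
      have : ((1 / 2 : ℝ) ^ n) ^ H = ((1 / 2 : ℝ) ^ H) ^ n := by
        rw [← Real.rpow_natCast, ← Real.rpow_mul (by norm_num), mul_comm,
          Real.rpow_mul (by norm_num), Real.rpow_natCast]
      rw [this, hρ, Real.rpow_sub (by norm_num), div_pow]
      field_simp
    have hm := hmom ((k : ℝ≥0) / 2 ^ n) (((k + 1 : ℕ) : ℝ≥0) / 2 ^ n)
    rw [hdist] at hm
    have hsplit : ∀ ω, Y n k ω = ENNReal.ofReal (ρ ^ n)⁻¹ ^ p *
        ‖X (((k + 1 : ℕ) : ℝ≥0) / 2 ^ n) ω - X ((k : ℝ≥0) / 2 ^ n) ω‖ₑ ^ p := by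
      intro ω
      simp only [Y]
      rw [enorm_mul, mul_pow, Real.enorm_of_nonneg (by positivity : 0 ≤ (ρ ^ n)⁻¹)]
    simp_rw [hsplit]
    rw [lintegral_const_mul' _ _ (by simp)]
    calc _ ≤ ENNReal.ofReal (ρ ^ n)⁻¹ ^ p *
          (C * ENNReal.ofReal (((1 / 2 : ℝ) ^ n) ^ H) ^ p) := by gcongr
      _ = C * ENNReal.ofReal ((ρ ^ n)⁻¹ * ((1 / 2 : ℝ) ^ n) ^ H) ^ p := by
          rw [ENNReal.ofReal_mul (by positivity), mul_pow]
          ring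
      _ = _ := by
          rw [hscale, ← ENNReal.ofReal_pow (by positivity), ← ENNReal.ofReal_pow (by positivity),
            ← pow_mul, ← pow_mul, mul_comm n p]
  have hsum : ∫⁻ ω, ∑' n, ∑ k ∈ Finset.range (N * 2 ^ n), Y n k ω ∂P ≠ ⊤ := by
    rw [lintegral_tsum (fun n => Finset.aemeasurable_fun_sum _ fun k _ => hYm n k)]
    have hle : ∀ n, ∫⁻ ω, ∑ k ∈ Finset.range (N * 2 ^ n), Y n k ω ∂P ≤
        N * C * ENNReal.ofReal θ ^ n := by
      intro n
      rw [lintegral_finsetSum' _ (fun k _ => hYm n k)]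
      refine (Finset.sum_le_card_nsmul _ _ _ fun k _ => hY n k).trans_eq ?_
      simp only [Finset.card_range, nsmul_eq_mul, θ]
      rw [ENNReal.ofReal_mul (by norm_num), mul_pow]
      push_cast
      rw [ENNReal.ofReal_ofNat]
      ring
    refine ne_top_of_le_ne_top ?_ (ENNReal.tsum_le_tsum hle)
    rw [ENNReal.tsum_mul_left, ENNReal.tsum_geometric]
    refine ENNReal.mul_ne_top (ENNReal.mul_ne_top (by simp) hC) (ENNReal.inv_ne_top.2 ?_)
    rw [← ENNReal.ofReal_one, ← ENNReal.ofReal_sub _ hθ0]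
    simpa using hθ1
  have hfin := ae_lt_top' (AEMeasurable.tsum fun n =>
    Finset.aemeasurable_fun_sum _ fun k _ => hYm n k) hsum
  filter_upwards [hfin] with ω hω
  set F := ∑' n, ∑ k ∈ Finset.range (N * 2 ^ n), Y n k ω with hF
  refine ⟨1 + F.toReal, by positivity, fun n k hk => ?_⟩
  have hle : Y n k ω ≤ F :=
    (Finset.single_le_sum (f := fun k => Y n k ω) (fun _ _ => zero_le)
      (Finset.mem_range.2 hk)).trans
      (ENNReal.le_tsum (f := fun n => ∑ k ∈ Finset.range (N * 2 ^ n), Y n k ω) n)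
  have hle' := ENNReal.toReal_mono hω.ne hle
  simp only [Y, ENNReal.toReal_pow, toReal_enorm, Real.norm_eq_abs, abs_mul] at hle'
  rw [abs_of_nonneg (by positivity : 0 ≤ (ρ ^ n)⁻¹)] at hle'
  set x := |X (((k + 1 : ℕ) : ℝ≥0) / 2 ^ n) ω - X ((k : ℝ≥0) / 2 ^ n) ω|
  have hx : (ρ ^ n)⁻¹ * x ≤ 1 + F.toReal := by
    rcases le_total ((ρ ^ n)⁻¹ * x) 1 with h1 | h1
    · exact h1.trans (le_add_of_nonneg_right ENNReal.toReal_nonneg)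
    · linarith [le_self_pow₀ h1 hp0]
  rwa [inv_mul_le_iff₀ (by positivity), mul_comm] at hx

theorem IsFractionalBrownianMotion.integral_sub_eq_zero [IsProbabilityMeasure P] {H : ℝ}
    {B : ℝ≥0 → Ω → ℝ} (hB : IsFractionalBrownianMotion P H B) (s t : ℝ≥0) :
    ∫ ω, (B t ω - B s ω) ∂P = 0 := by
  obtain ⟨ω, h1, h2⟩ := ((hB.mean_eq t).and (hB.mean_eq s)).exists
  rw [integral_sub (hB.isGaussianProcess.hasGaussianLaw_eval t).integrable
    (hB.isGaussianProcess.hasGaussianLaw_eval s).integrable, h1, h2, sub_self]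

theorem IsFractionalBrownianMotion.variance_sub [IsProbabilityMeasure P] {H : ℝ} (hH : 0 < H)
    {B : ℝ≥0 → Ω → ℝ} (hB : IsFractionalBrownianMotion P H B) (s t : ℝ≥0) :
    variance (fun ω => B t ω - B s ω) P = |(t : ℝ) - s| ^ (2 * H) := by
  have ht := (hB.isGaussianProcess.hasGaussianLaw_eval t).memLp_two
  have hs := (hB.isGaussianProcess.hasGaussianLaw_eval s).memLp_two
  have h := covariance_sub_sub ht hs ht hs
  rw [covariance_self (ht.sub hs).aemeasurable] at h
  change variance (B t - B s) P = _
  rw [h]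
  simp only [hB.covariance_eq, sub_self, abs_zero, Real.zero_rpow (by positivity : 2 * H ≠ 0)]
  rw [abs_sub_comm (s : ℝ) t]
  ring

/-- The moments of the increments of a fractional Brownian motion, which are centred Gaussian
variables with standard deviation `|t - s| ^ H`. -/
theorem IsFractionalBrownianMotion.lintegral_enorm_sub_pow [IsProbabilityMeasure P] {H : ℝ}
    (hH : 0 < H) {B : ℝ≥0 → Ω → ℝ} (hB : IsFractionalBrownianMotion P H B) (p : ℕ) (s t : ℝ≥0) :
    ∫⁻ ω, ‖B t ω - B s ω‖ₑ ^ p ∂P =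
      (∫⁻ x, ‖x‖ₑ ^ p ∂(gaussianReal 0 1)) * ENNReal.ofReal (|(t : ℝ) - s| ^ H) ^ p := by
  have hg : HasGaussianLaw (fun ω => B t ω - B s ω) P :=
    hB.isGaussianProcess.hasGaussianLaw_fun_sub
  have hmap := hg.map_eq_gaussianReal
  rw [hB.integral_sub_eq_zero, hB.variance_sub hH] at hmap
  have hvar : (|(t : ℝ) - s| ^ (2 * H)).toNNReal = (|(t : ℝ) - s| ^ H).toNNReal ^ 2 := by
    rw [← Real.toNNReal_pow (by positivity), mul_comm, Real.rpow_mul (abs_nonneg _),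
      Real.rpow_two]
  rw [hvar] at hmap
  rw [mul_comm]
  change _ = ((|(t : ℝ) - s| ^ H).toNNReal : ENNReal) ^ p * _
  rw [← lintegral_enorm_pow_gaussianReal, ← hmap, lintegral_map' (by fun_prop) hg.aemeasurable]

/-- Almost every path of a fractional Brownian motion is continuous and locally Hölder on `[0, T]`
of any order below `H`. -/
theorem IsFractionalBrownianMotion.ae_holder [IsProbabilityMeasure P] {H α : ℝ}
    (hα : 0 < α) (hαH : α < H) {B : ℝ≥0 → Ω → ℝ} (hB : IsFractionalBrownianMotion P H B)
    (T : ℝ≥0) :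
    ∀ᵐ ω ∂P, Continuous (fun x : ℝ => B x.toNNReal ω) ∧ ∃ L : ℝ, 0 ≤ L ∧
      ∀ s t : ℝ, 0 ≤ s → s ≤ t → t ≤ T → t - s ≤ 1 →
        |B t.toNNReal ω - B s.toNNReal ω| ≤ L * (t - s) ^ α := by
  obtain ⟨p, hp⟩ := exists_nat_gt (1 / (H - α))
  rw [div_lt_iff₀ (by linarith), mul_comm] at hp
  obtain ⟨N, hN⟩ := exists_nat_ge (T : ℝ)
  filter_upwards [hB.continuous_paths, ae_dyadic_increments_le hB.isGaussianProcess.aemeasurable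
    hp (lintegral_enorm_pow_gaussianReal_lt_top p).ne
    (fun s t => (hB.lintegral_enorm_sub_pow (hα.trans hαH) p s t).le) N] with ω hcont hdy
  obtain ⟨K, hK, hdy⟩ := hdy
  have hc : Continuous (fun x : ℝ => B x.toNNReal ω) := hcont.comp continuous_real_toNNReal
  obtain ⟨L, hL, hol⟩ := exists_holder_of_dyadic_increments (N := N) hc hK hα (by
    intro n k hk
    convert hdy n k hk using 5
    · ext
      rw [Real.coe_toNNReal _ (by positivity)]
      push_cast
      rfl
    · ext
      rw [Real.coe_toNNReal _ (by positivity)]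
      push_cast
      rfl)
  exact ⟨hc, L, hL, fun s t hs hst htT => hol s t hs hst (htT.trans hN)⟩

end

/-! ### A chain rule along Hölder paths -/

/-- If the increments of `F` agree with `f ξ * (g t - g s)` up to `o(t - s)`, uniformly in the
intervals `[s, t]` and tags `ξ`, then the Riemann sums of `f` against `g` tend to the total
increment of `F`. -/
theorem isRiemannSumLimit_of_increment_approx {f g F : ℝ≥0 → ℝ} {a b : ℝ≥0}
    (h : ∀ η : ℝ, 0 < η → ∃ δ : ℝ, 0 < δ ∧ ∀ s ξ t : ℝ≥0, s ≤ ξ → ξ ≤ t → t ≤ b →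
      (t : ℝ) - s < δ → |F t - F s - f ξ * (g t - g s)| ≤ η * ((t : ℝ) - s)) :
    IsRiemannSumLimit f g a b (F b - F a) := by
  intro ε hε
  obtain ⟨δ, hδ, hδ'⟩ := h (ε / (b + 1)) (by positivity)
  refine ⟨δ, hδ, ?_⟩
  rintro n π ξ ⟨h0, hn, hstep⟩
  have hmono : ∀ i, i ≤ n → π i ≤ b := by
    intro i hi
    rw [← hn]
    obtain ⟨m, rfl⟩ := Nat.exists_eq_add_of_le hi
    have hle : ∀ j, j ≤ m → π i ≤ π (i + j) := by
      intro j
      induction j with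
      | zero => exact fun _ => le_rfl
      | succ j ih =>
        intro hj
        have h := hstep (i + j) (by omega)
        exact (ih (by omega)).trans (h.1.trans h.2.1)
    exact hle m le_rfl
  have htel : ∑ i ∈ Finset.range n, (F (π (i + 1)) - F (π i)) = F b - F a := by
    rw [Finset.sum_range_sub (fun i => F (π i)), h0, hn]
  have htel' : ∑ i ∈ Finset.range n, ((π (i + 1) : ℝ) - π i) = b - a := by
    rw [Finset.sum_range_sub (fun i => (π i : ℝ)), h0, hn]
  rw [← htel, abs_sub_comm, riemannSum, ← Finset.sum_sub_distrib]
  calc _ ≤ ∑ i ∈ Finset.range n,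
        |F (π (i + 1)) - F (π i) - f (ξ i) * (g (π (i + 1)) - g (π i))| :=
        Finset.abs_sum_le_sum_abs _ _
    _ ≤ ∑ i ∈ Finset.range n, ε / (b + 1) * ((π (i + 1) : ℝ) - π i) := by
        refine Finset.sum_le_sum fun i hi => ?_
        have hi := Finset.mem_range.1 hi
        obtain ⟨h1, h2, h3⟩ := hstep i hi
        exact hδ' _ _ _ h1 h2 (hmono _ hi) h3
    _ = ε / (b + 1) * (b - a) := by rw [← Finset.mul_sum, htel']
    _ < ε := by
        rw [div_mul_eq_mul_div, div_lt_iff₀ (by positivity)]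
        have : (0 : ℝ) ≤ a := a.2
        nlinarith

/-- Second-order Taylor remainder of the exponential on `(-∞, M]`. -/
theorem abs_exp_sub_exp_sub_le {m y M : ℝ} (hm : m ≤ M) (hy : y ≤ M) :
    |Real.exp y - Real.exp m - Real.exp m * (y - m)| ≤ Real.exp M * (y - m) ^ 2 := by
  -- the tangents at `m` and at `y` bound the exponential from below
  have tangent : ∀ a c : ℝ, Real.exp a * (c - a) ≤ Real.exp c - Real.exp a := by
    intro a c
    have h := mul_le_mul_of_nonneg_left (Real.add_one_le_exp (c - a)) (Real.exp_pos a).le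
    rw [← Real.exp_add] at h
    simp only [add_sub_cancel] at h
    linarith
  have h1 := tangent m y
  have h2 := tangent y m
  have em := Real.exp_le_exp.2 hm
  have ey := Real.exp_le_exp.2 hy
  rw [abs_of_nonneg (by linarith)]
  have h3 : Real.exp y - Real.exp m - Real.exp m * (y - m) ≤
      (Real.exp y - Real.exp m) * (y - m) := by linarith
  refine h3.trans ?_
  rcases le_total m y with hmy | hmy
  · nlinarith [mul_le_mul_of_nonneg_right ey (sq_nonneg (y - m)),
      mul_le_mul_of_nonneg_right (by linarith : Real.exp y - Real.exp m ≤ Real.exp y * (y - m))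
        (sub_nonneg.2 hmy)]
  · nlinarith [mul_le_mul_of_nonneg_right em (sq_nonneg (y - m)),
      mul_le_mul_of_nonneg_right (by linarith : Real.exp m - Real.exp y ≤ Real.exp m * (m - y))
        (sub_nonneg.2 hmy)]

/-- The logarithm `(1/T) ∫₀ˣ b + ((T - x) / T) b x` of the geometric average of `exp b`. -/
noncomputable def logAverage (b : ℝ → ℝ) (T x : ℝ) : ℝ :=
  1 / T * (∫ u in (0 : ℝ)..x, b u) + (T - x) / T * b x

theorem continuous_logAverage {b : ℝ → ℝ} (hb : Continuous b) (T : ℝ) :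
    Continuous (logAverage b T) := by
  have h : Continuous fun x => ∫ u in (0 : ℝ)..x, b u :=
    intervalIntegral.continuous_primitive (fun _ _ => hb.intervalIntegrable _ _) 0
  unfold logAverage
  fun_prop

/-- The increments of `logAverage b T` are `(T - ξ) / T` times those of `b`, up to the oscillation
of `b` times the length of the interval: the drift `-b / T` of the coefficient `(T - x) / T`
cancels the derivative of the integral. -/
theorem abs_logAverage_sub_sub_le {b : ℝ → ℝ} (hb : Continuous b) {T s ξ t D : ℝ} (hT : 0 < T)
    (hs : s ≤ ξ) (ht : ξ ≤ t) (hD : ∀ x y, s ≤ x → x ≤ y → y ≤ t → |b y - b x| ≤ D) :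
    |logAverage b T t - logAverage b T s - (T - ξ) / T * (b t - b s)| ≤ D * ((t - s) / T) := by
  have hi : ∀ x y, IntervalIntegrable b volume x y := fun x y => hb.intervalIntegrable x y
  have e1 : ∫ u in s..ξ, (b u - b s) = (∫ u in s..ξ, b u) - (ξ - s) * b s := by
    rw [intervalIntegral.integral_sub (hi _ _) (by simp)]
    simp
  have e2 : ∫ u in ξ..t, (b u - b t) = (∫ u in ξ..t, b u) - (t - ξ) * b t := by
    rw [intervalIntegral.integral_sub (hi _ _) (by simp)]
    simp
  have e3 : (∫ u in (0 : ℝ)..t, b u) =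
      (∫ u in (0 : ℝ)..s, b u) + (∫ u in s..ξ, b u) + ∫ u in ξ..t, b u := by
    rw [intervalIntegral.integral_add_adjacent_intervals (hi _ _) (hi _ _),
      intervalIntegral.integral_add_adjacent_intervals (hi _ _) (hi _ _)]
  have key : logAverage b T t - logAverage b T s - (T - ξ) / T * (b t - b s) =
      ((∫ u in s..ξ, (b u - b s)) + ∫ u in ξ..t, (b u - b t)) / T := by
    rw [e1, e2, logAverage, logAverage, e3]
    field_simp
    ring
  have b1 : |∫ u in s..ξ, (b u - b s)| ≤ D * (ξ - s) := by
    have := intervalIntegral.norm_integral_le_of_norm_le_const (a := s) (b := ξ) (C := D)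
      (f := fun u => b u - b s) (fun u hu => by
        rw [Set.uIoc_of_le hs] at hu
        exact hD s u le_rfl hu.1.le (hu.2.trans ht))
    rwa [abs_of_nonneg (sub_nonneg.2 hs)] at this
  have b2 : |∫ u in ξ..t, (b u - b t)| ≤ D * (t - ξ) := by
    have := intervalIntegral.norm_integral_le_of_norm_le_const (a := ξ) (b := t) (C := D)
      (f := fun u => b u - b t) (fun u hu => by
        rw [Set.uIoc_of_le ht] at hu
        rw [norm_sub_rev]
        exact hD u t (hs.trans hu.1.le) hu.2 le_rfl)
    rwa [abs_of_nonneg (sub_nonneg.2 ht)] at this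
  rw [key, abs_div, abs_of_pos hT, ← mul_div_assoc]
  gcongr
  refine (abs_add_le _ _).trans ?_
  linarith

/-- One-step estimate for `exp (logAverage b T)` on an interval where `b` oscillates by at most
`D`. -/
theorem abs_exp_logAverage_sub_sub_le {b : ℝ → ℝ} (hb : Continuous b) {T s ξ t D M : ℝ}
    (hT : 0 < T) (hs0 : 0 ≤ s) (hs : s ≤ ξ) (ht : ξ ≤ t) (htT : t ≤ T)
    (hD : ∀ x y, s ≤ x → x ≤ y → y ≤ t → |b y - b x| ≤ D)
    (hM : ∀ x, 0 ≤ x → x ≤ T → logAverage b T x ≤ M) :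
    |Real.exp (logAverage b T t) - Real.exp (logAverage b T s) -
      (T - ξ) / T * Real.exp (logAverage b T ξ) * (b t - b s)| ≤
      Real.exp M * (D * ((t - s) / T) + 8 * D ^ 2) := by
  have hD0 : 0 ≤ D := (abs_nonneg _).trans (hD s t le_rfl (hs.trans ht) le_rfl)
  have lip : ∀ x y, s ≤ x → x ≤ y → y ≤ t →
      |logAverage b T y - logAverage b T x| ≤ 2 * D := by
    intro x y hx hxy hy
    have h := abs_logAverage_sub_sub_le hb hT le_rfl hxy
      (fun x' y' hx' hxy' hy' => hD x' y' (hx.trans hx') hxy' (hy'.trans hy))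
    have hc0 : 0 ≤ (T - x) / T := div_nonneg (by linarith) hT.le
    have hc1 : (T - x) / T ≤ 1 := (div_le_one hT).2 (by linarith)
    have hl : (y - x) / T ≤ 1 := (div_le_one hT).2 (by linarith)
    have h2 : |(T - x) / T * (b y - b x)| ≤ D := by
      rw [abs_mul, abs_of_nonneg hc0]
      exact (mul_le_of_le_one_left (abs_nonneg _) hc1).trans (hD x y hx hxy hy)
    have h3 : D * ((y - x) / T) ≤ D := mul_le_of_le_one_right hD0 hl
    have h4 := abs_add_le (logAverage b T y - logAverage b T x - (T - x) / T * (b y - b x))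
      ((T - x) / T * (b y - b x))
    rw [sub_add_cancel] at h4
    linarith
  have h0 := abs_logAverage_sub_sub_le hb hT hs ht hD
  have l1 := lip ξ t hs ht le_rfl
  have l2 := lip s ξ le_rfl hs ht
  rw [abs_sub_comm] at l2
  have hMs := hM s hs0 (by linarith)
  have hMξ := hM ξ (by linarith) (by linarith)
  have hMt := hM t (by linarith) htT
  set u := logAverage b T
  have q1 := abs_exp_sub_exp_sub_le hMξ hMt
  have q2 := abs_exp_sub_exp_sub_le hMξ hMs
  have s1 : (u t - u ξ) ^ 2 ≤ (2 * D) ^ 2 := sq_le_sq' (abs_le.1 l1).1 (abs_le.1 l1).2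
  have s2 : (u s - u ξ) ^ 2 ≤ (2 * D) ^ 2 := sq_le_sq' (abs_le.1 l2).1 (abs_le.1 l2).2
  have e : Real.exp (u t) - Real.exp (u s) - (T - ξ) / T * Real.exp (u ξ) * (b t - b s) =
      Real.exp (u ξ) * (u t - u s - (T - ξ) / T * (b t - b s)) +
      (Real.exp (u t) - Real.exp (u ξ) - Real.exp (u ξ) * (u t - u ξ)) +
      -(Real.exp (u s) - Real.exp (u ξ) - Real.exp (u ξ) * (u s - u ξ)) := by ring
  rw [e]
  refine (abs_add_three _ _ _).trans ?_
  rw [abs_neg, abs_mul, abs_of_pos (Real.exp_pos _)]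
  calc _ ≤ Real.exp M * (D * ((t - s) / T)) + Real.exp M * (2 * D) ^ 2 +
        Real.exp M * (2 * D) ^ 2 := by
        gcongr ?_ + ?_ + ?_
        · gcongr
        · exact q1.trans (by gcongr)
        · exact q2.trans (by gcongr)
    _ = _ := by ring

/-- Along a path that is Hölder of order `α > 1/2`, the Riemann sums of
`(T - s) / T * exp (logAverage b T s)` against the path tend to the increment of
`exp (logAverage b T)`. -/
theorem isRiemannSumLimit_exp_logAverage {b : ℝ → ℝ} (hb : Continuous b) {T t : ℝ≥0} {α L : ℝ}
    (hT : 0 < T) (ht : t ≤ T) (hα : 1 / 2 < α) (hL : 0 ≤ L)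
    (hol : ∀ s t : ℝ, 0 ≤ s → s ≤ t → t ≤ T → t - s ≤ 1 → |b t - b s| ≤ L * (t - s) ^ α) :
    IsRiemannSumLimit
      (fun s : ℝ≥0 => ((T : ℝ) - s) / T * Real.exp (logAverage b T s)) (fun s : ℝ≥0 => b s) 0 t
      (Real.exp (logAverage b T t) - Real.exp (b 0)) := by
  have hT' : (0 : ℝ) < T := hT
  have hF0 : Real.exp (b 0) = Real.exp (logAverage b T ((0 : ℝ≥0) : ℝ)) := by
    simp [logAverage, hT'.ne']
  rw [hF0]
  refine isRiemannSumLimit_of_increment_approx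
    (F := fun s : ℝ≥0 => Real.exp (logAverage b T s)) ?_
  intro η hη
  obtain ⟨M, hM⟩ := (isCompact_Icc (a := (0 : ℝ)) (b := T)).exists_bound_of_continuousOn
    (continuous_logAverage hb T).continuousOn
  -- on an interval of length `x` the one-step error is at most `w x * x`
  let w : ℝ → ℝ := fun x => Real.exp M * (L / T * x ^ α + 8 * L ^ 2 * x ^ (2 * α - 1))
  have hw : ContinuousAt w 0 := by
    have h1 : ContinuousAt (fun x : ℝ => x ^ α) 0 :=
      Real.continuousAt_rpow_const _ _ (Or.inr (by linarith))
    have h2 : ContinuousAt (fun x : ℝ => x ^ (2 * α - 1)) 0 :=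
      Real.continuousAt_rpow_const _ _ (Or.inr (by linarith))
    fun_prop
  have hw0 : w 0 = 0 := by
    simp [w, Real.zero_rpow (by linarith : α ≠ 0), Real.zero_rpow (by linarith : 2 * α - 1 ≠ 0)]
  obtain ⟨δ, hδ, hwδ⟩ := Metric.continuousAt_iff.1 hw η hη
  refine ⟨min δ 1, by positivity, fun s ξ r hs hr hrt hlen => ?_⟩
  have hs' : (s : ℝ) ≤ ξ := hs
  have hr' : (ξ : ℝ) ≤ r := hr
  have hrT : (r : ℝ) ≤ T := hrt.trans ht
  have hs0 : (0 : ℝ) ≤ s := s.2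
  set x : ℝ := (r : ℝ) - s with hx
  have hx0 : 0 ≤ x := by linarith
  have hx1 : x < 1 := hlen.trans_le (min_le_right _ _)
  have hwx : w x ≤ η := by
    have := hwδ (x := x) (by
      rw [Real.dist_eq, sub_zero, abs_of_nonneg hx0]
      exact hlen.trans_le (min_le_left _ _))
    rw [hw0, Real.dist_eq, sub_zero] at this
    exact (le_abs_self _).trans this.le
  have hone := abs_exp_logAverage_sub_sub_le hb hT' hs0 hs' hr' hrT (D := L * x ^ α) (M := M)
    (fun y z hy hyz hz => (hol y z (by linarith) hyz (by linarith) (by linarith)).trans (by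
      have : (z - y) ^ α ≤ x ^ α :=
        Real.rpow_le_rpow (by linarith) (by linarith) (by linarith)
      gcongr))
    (fun y hy0 hyT => (le_abs_self _).trans (hM y ⟨hy0, hyT⟩))
  refine hone.trans ?_
  have hpow : (x ^ α) ^ 2 = x ^ (2 * α - 1) * x := by
    rcases hx0.eq_or_lt with h | h
    · rw [← h, Real.zero_rpow (by linarith)]
      simp
    · rw [← Real.rpow_add_one h.ne', ← Real.rpow_natCast, ← Real.rpow_mul hx0]
      congr 1
      push_cast
      ring
  calc Real.exp M * (L * x ^ α * (x / T) + 8 * (L * x ^ α) ^ 2) = w x * x := by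
        rw [mul_pow, hpow]
        simp only [w]
        ring
    _ ≤ η * x := by gcongr

theorem geometricAverage_eq_exp_logAverage {Ω : Type*} (B : ℝ≥0 → Ω → ℝ) (T t : ℝ≥0) (ω : Ω) :
    geometricAverage B T t ω = Real.exp (logAverage (fun x => B x.toNNReal ω) T t) := by
  simp only [geometricAverage, geometricProcess, logAverage, Real.log_exp, Real.toNNReal_coe]
  rw [← Real.exp_mul, ← Real.exp_add, mul_comm (B t ω)]

theorem proposition2p3 {Ω : Type*} [MeasurableSpace Ω] (P : Measure Ω) [IsProbabilityMeasure P]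
    (H : ℝ) (hH : 1 / 2 < H) (hH1 : H < 1)
    (B : ℝ≥0 → Ω → ℝ) (hB : IsFractionalBrownianMotion P H B)
    (T : ℝ≥0) (hT : 0 < T) :
    (∀ᵐ ω ∂P, ∀ t : ℝ≥0, t ≤ T → ∃ I : ℝ,
      IsRiemannSumLimit (fun s => ((T : ℝ) - (s : ℝ)) / (T : ℝ) * geometricAverage B T s ω)
        (fun s => B s ω) 0 t I ∧
      geometricAverage B T t ω = geometricProcess B 0 ω + I) ∧
    (∀ᵐ ω ∂P, ∃ I : ℝ,
      IsRiemannSumLimit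
        (fun s => ((T : ℝ) - (s : ℝ)) / (T : ℝ) *
          Real.exp (1 / (T : ℝ) * (∫ u in (0 : ℝ)..(s : ℝ), B u.toNNReal ω) +
            ((T : ℝ) - (s : ℝ)) / (T : ℝ) * B s ω))
        (fun s => B s ω) 0 T I ∧
      Real.exp (1 / (T : ℝ) * ∫ s in (0 : ℝ)..(T : ℝ), B s.toNNReal ω) =
        geometricProcess B 0 ω + I) := by
  have main : ∀ᵐ ω ∂P, ∀ t : ℝ≥0, t ≤ T → IsRiemannSumLimit
      (fun s => ((T : ℝ) - (s : ℝ)) / (T : ℝ) * geometricAverage B T s ω) (fun s => B s ω) 0 t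
      (geometricAverage B T t ω - geometricProcess B 0 ω) := by
    filter_upwards [hB.ae_holder (α := (1 / 2 + H) / 2) (by linarith) (by linarith) T]
      with ω ⟨hc, L, hL, hol⟩ t ht
    have h := isRiemannSumLimit_exp_logAverage hc hT ht (by linarith) hL hol
    simpa only [geometricAverage_eq_exp_logAverage, geometricProcess, Real.toNNReal_coe,
      Real.toNNReal_zero] using h
  constructor
  · filter_upwards [main] with ω h t ht
    exact ⟨_, h t ht, by ring⟩
  · filter_upwards [main] with ω h
    refine ⟨_, ?_, (add_sub_cancel _ _).symm⟩
    have h := h T le_rfl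
    simp only [geometricAverage_eq_exp_logAverage, logAverage, Real.toNNReal_coe, sub_self,
      zero_div, zero_mul, add_zero] at h
    exact h
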